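/- **Setting.** All Hilbert spaces are complex and inner products are linear in the second argument. A *self-dual cone* in a Hilbert space $\mathfrak H$ is a closed convex set $\mathfrak P\subset\mathfrak H$ with $t\mathfrak P\subseteq\mathfrak P$ for $t\ge 0$, $\mathfrak P\cap(-\mathfrak P)=\{0\}$ and $\mathfrak P=\{\eta\in\mathfrak H : \langle\eta|\xi\rangle\ge 0\ \ \forall \xi\in\mathfrak P\}$. A vector $\eta\in\mathfrak P$ is *strictly positive* if $\langle\xi|\eta\rangle>0$ for all $\xi\in\mathfrak P\setminus\{0\}$. A bounded operator $A$ *preserves positivity* w.r.t. $\mathfrak P$ if $A\mathfrak P\subseteq\mathfrak P$, and *improves positivity* if $A\xi$ is strictly positive for all $\xi\in\mathfrak P\setminus\{0\}$. For a self-dual cone $\mathfrak P$, $\mathscr A^+_{\mathfrak P}$ is the set of self-adjoint operators $H$ that are bounded from below, have purely discrete spectrum (isolated eigenvalues of finite multiplicity), and whose resolvent $(H+s)^{-1}$ improves positivity w.r.t. $\mathfrak P$ for all $s>-E(H)$, where $E(H)=\inf\mathrm{spec}(H)$. Let $\mathfrak H_*$ be a Hilbert space and $O$ a bounded self-adjoint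 operator on $\mathfrak H_*$ with discrete spectrum, in the (weak) sense that the eigenvectors of $O$ span a dense subspace. On every Hilbert space $\mathfrak H\supseteq\mathfrak H_*$ containing $\mathfrak H_*$ as a closed subspace, $O$ is extended to $O\oplus 0$ on $\mathfrak H_*\oplus\mathfrak H_*^\perp$, again denoted by $O$. Let $\mathscr P(O)$ be the class of all operators $H$ acting in some Hilbert space $\mathfrak H\supseteq\mathfrak H_*$ such that $H\in\mathscr A^+_{\mathfrak P}$ for some self-dual cone $\mathfrak P\subset\mathfrak H$ and $e^{isO}e^{itH}=e^{itH}e^{isO}$ for all $s,t\in\mathbb R$. Let $H_1$, $H_2$ act in $\mathfrak H_1$, $\mathfrak H_2$, where $\mathfrak H_*\subseteq\mathfrak H_1\subseteq\mathfrak H_2$ as closed subspaces, let $\pi$ be the orthogonal projection of $\mathfrak H_2$ onto $\mathfrak H_1$, and let $\mathfrak P_j\subset\mathfrak H_j$ be self-dual cones. Write $(H_1,\mathfrak P_1)\to(H_2,\mathfrak P_2)$ if $H_j\in\mathscr A^+_{\mathfrak P_j}$ for $j=1,2$, $\mathfrak P_1=\pi\mathfrak P_2$, and $\pi$ preserves positivity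 w.r.t. $\mathfrak P_2$. For $H,K\in\mathscr P(O)$ write $H\to K$ if there are $H=H_1,H_2,\dots,H_N=K$ in $\mathscr P(O)$ $(N\ge 2)$, and self-dual cones $\mathfrak P_j$ $(1\le j\le N-1)$ and $\mathfrak P_j'$ $(2\le j\le N)$ in the space of $H_j$, with $(H_j,\mathfrak P_j)\to(H_{j+1},\mathfrak P_{j+1}')$ for $1\le j\le N-1$. **Theorem.** Let $H_*\in\mathscr P(O)$ act in a nonzero Hilbert space, and let $H\in\mathscr P(O)$ belong to the $H_*$-stability class, i.e. $H_*\to H$. Then $E(H_*)$ and $E(H)$ are simple eigenvalues of $H_*$ and $H$, respectively, with eigenvectors $\psi_{H_*}$, $\psi_H$ which are eigenvectors of $O$, $$O\psi_{H_*}=\mu(H_*)\,\psi_{H_*},\qquad O\psi_H=\mu(H)\,\psi_H ,$$ and $\mu(H)=\mu(H_*)$. -/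

import Mathlib

universe u v

open scoped ComplexOrder

namespace GoodQN

/-! ### Self-dual cones and positivity -/

section Cones

variable {E : Type v} [NormedAddCommGroup E] [InnerProductSpace ℂ E]

/-- A convex cone in a complex Hilbert space: a closed convex set, stable under multiplication by
nonnegative reals, with `P ∩ (-P) = {0}`. -/
structure IsConvexCone (P : Set E) : Prop where
  isClosed : IsClosed P
  convex : Convex ℝ P
  smul_mem : ∀ t : ℝ, 0 ≤ t → ∀ x ∈ P, (t : ℂ) • x ∈ P
  salient : P ∩ {x | -x ∈ P} = {0}

/-- The dual cone. The order on `ℂ` is the one of `ComplexOrder`: `0 ≤ z` means that `z` is real and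
nonnegative, and `0 < z` that `z` is real and positive. -/
def dualCone (P : Set E) : Set E := {η | ∀ ξ ∈ P, 0 ≤ inner ℂ η ξ}

/-- Self-dual cones. -/
structure IsSelfDualCone (P : Set E) : Prop extends IsConvexCone P where
  self_dual : P = dualCone P

/-- `η > 0` with respect to `P`. -/
def StrictlyPositive (P : Set E) (η : E) : Prop :=
  η ∈ P ∧ ∀ ξ ∈ P, ξ ≠ 0 → 0 < inner ℂ ξ η

/-- `A ⊵ 0` with respect to `P`: `A` preserves positivity. -/
def PositivityPreserving (P : Set E) (A : E →L[ℂ] E) : Prop :=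
  ∀ ξ ∈ P, A ξ ∈ P

/-- `A ▷ 0` with respect to `P`: `A` improves positivity. -/
def PositivityImproving (P : Set E) (A : E →L[ℂ] E) : Prop :=
  ∀ ξ ∈ P, ξ ≠ 0 → StrictlyPositive P (A ξ)

end Cones

/-! ### Unbounded operators: resolvent, spectrum, lowest energy, unitary group

An (unbounded) operator is a partially defined linear map `A : E →ₗ.[ℂ] E`; Mathlib's
`IsSelfAdjoint A` means that `A` equals its Hilbert space adjoint, domains included (and it forces
the domain to be dense). -/

section Operators

variable {E : Type v} [NormedAddCommGroup E] [InnerProductSpace ℂ E]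

/-- `R` is the bounded everywhere defined inverse `(A - z)⁻¹` of `A - z : dom A → E`. -/
structure IsResolventAt (A : E →ₗ.[ℂ] E) (z : ℂ) (R : E →L[ℂ] E) : Prop where
  right_inv : ∀ x : E, ∃ h : R x ∈ A.domain, A ⟨R x, h⟩ - z • R x = x
  left_inv : ∀ x : A.domain, R (A x - z • (x : E)) = (x : E)

/-- The spectrum of an operator: the complement of its resolvent set. -/
def opSpectrum (A : E →ₗ.[ℂ] E) : Set ℂ :=
  {z | ¬ ∃ R : E →L[ℂ] E, IsResolventAt A z R}

/-- The space `ker (A - z)`. -/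
def opEigenspace (A : E →ₗ.[ℂ] E) (z : ℂ) : Submodule ℂ E where
  carrier := {x | (x, z • x) ∈ A.graph}
  zero_mem' := by
    change ((0 : E), z • (0 : E)) ∈ A.graph
    rw [smul_zero]
    exact A.graph.zero_mem
  add_mem' := by
    intro x y hx hy
    simpa [smul_add] using A.graph.add_mem hx hy
  smul_mem' := by
    intro c x hx
    simpa [smul_comm c z x] using A.graph.smul_mem c hx

/-- `E(A) = inf spec(A)`, for `A` self-adjoint (so that its spectrum is real). -/
noncomputable def lowestEnergy (A : E →ₗ.[ℂ] E) : ℝ :=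
  sInf {t : ℝ | (t : ℂ) ∈ opSpectrum A}

/-- The operator is bounded from below. -/
def BoundedBelow (A : E →ₗ.[ℂ] E) : Prop :=
  ∃ c : ℝ, ∀ x : A.domain, c * ‖(x : E)‖ ^ 2 ≤ (inner ℂ (x : E) (A x)).re

/-- Purely discrete spectrum: the spectrum consists of isolated points which are eigenvalues of
finite multiplicity. -/
def HasPurelyDiscreteSpectrum (A : E →ₗ.[ℂ] E) : Prop :=
  ∀ z ∈ opSpectrum A,
    (∃ ε : ℝ, 0 < ε ∧ ∀ w ∈ opSpectrum A, dist w z < ε → w = z) ∧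
    opEigenspace A z ≠ ⊥ ∧ FiniteDimensional ℂ (opEigenspace A z)

/-- The class of self-adjoint operators `A`, bounded from below, with purely discrete spectrum, such
that `(A + s)⁻¹ ▷ 0` with respect to `P` for all `s > -E(A)`. -/
structure PositiveClass [CompleteSpace E] (P : Set E) (A : E →ₗ.[ℂ] E) : Prop where
  isSelfAdjoint : IsSelfAdjoint A
  boundedBelow : BoundedBelow A
  discrete : HasPurelyDiscreteSpectrum A
  improving : ∀ s : ℝ, -lowestEnergy A < s →
    ∃ R : E →L[ℂ] E, IsResolventAt A (-(s : ℂ)) R ∧ PositivityImproving P R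

/-- `U t = e^{itA}`: the strongly continuous one-parameter unitary group generated by `A`, i.e. `x`
is in the domain of `A` with `A x = y` iff `d/dt U(t) x` exists at `t = 0` and equals `i y`. By
Stone's theorem, for `A` self-adjoint there is exactly one such `U`. -/
structure IsUnitaryGroupOf [CompleteSpace E] (A : E →ₗ.[ℂ] E) (U : ℝ → (E →L[ℂ] E)) : Prop where
  unitary_mem : ∀ t, U t ∈ unitary (E →L[ℂ] E)
  map_zero : U 0 = 1
  map_add : ∀ s t, U (s + t) = U s * U t
  continuous : ∀ x, Continuous fun t => U t x
  generator : ∀ x y : E,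
    (x, y) ∈ A.graph ↔ HasDerivAt (fun t : ℝ => U t x) (Complex.I • y) 0

/-- `A` commutes strongly with the bounded operator `B`:
`e^{isB} e^{itA} = e^{itA} e^{isB}` for all real `s`, `t`. -/
def StronglyCommutes [CompleteSpace E] (A : E →ₗ.[ℂ] E) (B : E →L[ℂ] E) : Prop :=
  ∃ U : ℝ → (E →L[ℂ] E), IsUnitaryGroupOf A U ∧
    ∀ s t : ℝ, NormedSpace.exp ((Complex.I * (s : ℂ)) • B) * U t =
      U t * NormedSpace.exp ((Complex.I * (s : ℂ)) • B)

/-- The eigenvectors of a bounded operator span a dense subspace (pure point spectrum). -/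
def HasTotalEigenvectors (B : E →L[ℂ] E) : Prop :=
  (⨆ z : ℂ, Module.End.eigenspace (B : E →ₗ[ℂ] E) z).topologicalClosure = ⊤

end Operators

/-! ### Operators on Hilbert spaces containing a fixed one -/

/-- An operator acting in some Hilbert space that contains the fixed space `𝔥` as a closed subspace
(through a given isometric embedding). -/
structure OperatorOver (𝔥 : Type u) [NormedAddCommGroup 𝔥] [InnerProductSpace ℂ 𝔥] where
  Space : Type v
  [group : NormedAddCommGroup Space]
  [innerProductSpace : InnerProductSpace ℂ Space]
  [complete : CompleteSpace Space]
  embed : 𝔥 →ₗᵢ[ℂ] Space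
  op : Space →ₗ.[ℂ] Space

attribute [instance] OperatorOver.group OperatorOver.innerProductSpace OperatorOver.complete

section Main

variable {𝔥 : Type u} [NormedAddCommGroup 𝔥] [InnerProductSpace ℂ 𝔥] [CompleteSpace 𝔥]

/-- The natural extension `O ⊕ 0` of `O`, for the decomposition `𝔥 ⊕ 𝔥^⊥` of the larger space. -/
noncomputable def extend (O : 𝔥 →L[ℂ] 𝔥) (H : OperatorOver.{u, v} 𝔥) :
    H.Space →L[ℂ] H.Space :=
  H.embed.toContinuousLinearMap ∘L O ∘L
    ContinuousLinearMap.adjoint H.embed.toContinuousLinearMap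

/-- The class of all operators `H`, acting in a Hilbert space containing `𝔥`, with
positivity-improving resolvent with respect to some self-dual cone, which commute strongly with
(the natural extension of) `O`. -/
structure MemClass (O : 𝔥 →L[ℂ] 𝔥) (H : OperatorOver.{u, v} 𝔥) : Prop where
  positive : ∃ P : Set H.Space, IsSelfDualCone P ∧ PositiveClass P H.op
  commutes : StronglyCommutes H.op (extend O H)

/-- The positivity is inherited from `P₁` to `P₂`: with `π` the orthogonal projection of `E₂` onto
its closed subspace `E₁` (embedded by `j`), `P₁ = π P₂`, and `π ⊵ 0` with respect to `P₂`. As a map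
to `E₁`, the projection is the adjoint of `j`. -/
def Inherited {E₁ E₂ : Type v} [NormedAddCommGroup E₁] [InnerProductSpace ℂ E₁] [CompleteSpace E₁]
    [NormedAddCommGroup E₂] [InnerProductSpace ℂ E₂] [CompleteSpace E₂]
    (j : E₁ →ₗᵢ[ℂ] E₂) (P₁ : Set E₁) (P₂ : Set E₂) : Prop :=
  P₁ = ContinuousLinearMap.adjoint j.toContinuousLinearMap '' P₂ ∧
  PositivityPreserving P₂
    (j.toContinuousLinearMap ∘L ContinuousLinearMap.adjoint j.toContinuousLinearMap)

/-- One link `(H₁, P₁) → (H₂, P₂)` of a chain, for some self-dual cones `P₁`, `P₂`: the space of `H₁`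
is a closed subspace of that of `H₂` (compatibly with the copies of `𝔥` in both), and the strict
`P₂`-positivity of `H₂` is inherited from the strict `P₁`-positivity of `H₁`. -/
def Link (H₁ H₂ : OperatorOver.{u, v} 𝔥) : Prop :=
  ∃ (j : H₁.Space →ₗᵢ[ℂ] H₂.Space) (P₁ : Set H₁.Space) (P₂ : Set H₂.Space),
    (∀ x, j (H₁.embed x) = H₂.embed x) ∧
    IsSelfDualCone P₁ ∧ IsSelfDualCone P₂ ∧
    PositiveClass P₁ H₁.op ∧ PositiveClass P₂ H₂.op ∧
    Inherited j P₁ P₂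

/-- The preorder `H → K` on the class of `O`: there is a finite chain of links from `H` to `K` inside
the class. The cones of two consecutive links need not be related. -/
def Arrow (O : 𝔥 →L[ℂ] 𝔥) : OperatorOver.{u, v} 𝔥 → OperatorOver.{u, v} 𝔥 → Prop :=
  Relation.TransGen fun H₁ H₂ => MemClass O H₁ ∧ MemClass O H₂ ∧ Link H₁ H₂

/-- The stability class of `Hs`. -/
def stabilityClass (O : 𝔥 →L[ℂ] 𝔥) (Hs : OperatorOver.{u, v} 𝔥) : Set (OperatorOver.{u, v} 𝔥) :=
  {H | MemClass O H ∧ Arrow O Hs H}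

/-- `E(H)` is a simple eigenvalue of `H`, and `m` is the eigenvalue of `O` for the ground state:
`ker (H - E(H))` is spanned by one nonzero vector `ψ`, and `O ψ = m ψ`. -/
def IsGoodQuantumNumber (O : 𝔥 →L[ℂ] 𝔥) (H : OperatorOver.{u, v} 𝔥) (m : ℝ) : Prop :=
  ∃ ψ : H.Space, ψ ≠ 0 ∧ opEigenspace H.op (lowestEnergy H.op : ℂ) = Submodule.span ℂ {ψ} ∧
    extend O H ψ = (m : ℂ) • ψ

/-- The good quantum number `μ(H)`: the (unique) `m` with `IsGoodQuantumNumber O H m`, and an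
arbitrary number if there is none. -/
noncomputable def goodQuantumNumber (O : 𝔥 →L[ℂ] 𝔥) (H : OperatorOver.{u, v} 𝔥) : ℝ :=
  Classical.epsilon fun m : ℝ => IsGoodQuantumNumber O H m

end Main

end GoodQN

/-! The mechanism is overlap of ground states. A resolvent of `H` below its spectrum is
self-adjoint, improves positivity, and has its norm as an eigenvalue, so Perron-Frobenius
(`PositivityImproving.exists_groundState`) makes `E(H)` simple with a strictly positive eigenvector
(`PositiveClass.exists_groundState`). Strong commutation makes `O` preserve this one-dimensional
eigenspace, so the ground state is an eigenvector of `O`. Along a link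
(`Link.goodQuantumNumber_eq`), positivity of `π` places the smaller ground state in the larger cone,
where its inner product with the larger, strictly positive ground state is nonzero. Eigenvectors of
the symmetric operator `O` that are not orthogonal share their eigenvalue. Chains follow by
induction. -/

namespace GoodQN

/-! ### Self-dual cones and Perron-Frobenius theory. -/

section SelfDual

variable {E : Type v} [NormedAddCommGroup E] [InnerProductSpace ℂ E]

/-- Projection onto a closed convex cone: the remainder lies in the polar cone and is orthogonal to
the projection. -/
theorem exists_projection_cone [CompleteSpace E] {K : Set E} (hc : IsClosed K) (hconv : Convex ℝ K)
    (h0 : (0 : E) ∈ K) (h2 : ∀ x ∈ K, (2 : ℝ) • x ∈ K) (x : E) :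
    ∃ p ∈ K, (inner ℂ (x - p) p).re = 0 ∧ ∀ q ∈ K, (inner ℂ (x - p) q).re ≤ 0 := by
  let : InnerProductSpace ℝ E := InnerProductSpace.complexToReal
  obtain ⟨p, hp, hmin⟩ := exists_norm_eq_iInf_of_complete_convex ⟨0, h0⟩ hc.isComplete hconv x
  have key : ∀ w ∈ K, (inner ℂ (x - p) (w - p)).re ≤ 0 :=
    (norm_eq_iInf_iff_real_inner_le_zero hconv hp).1 hmin
  -- Testing at `0` and at `2p` bounds the real part of `⟨x - p, p⟩` from both sides.
  have k0 := key 0 h0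
  have k2 := key _ (h2 p hp)
  rw [two_smul, add_sub_cancel_right] at k2
  rw [zero_sub, inner_neg_right, Complex.neg_re] at k0
  have hz : (inner ℂ (x - p) p).re = 0 := by linarith
  refine ⟨p, hp, hz, fun q hq => ?_⟩
  have := key q hq
  rw [inner_sub_right, Complex.sub_re, hz] at this
  linarith

/-- The vectors whose inner products with all elements of `P` are real. -/
def realForm (P : Set E) : Submodule ℝ E where
  carrier := {x | ∀ p ∈ P, (inner ℂ x p).im = 0}
  zero_mem' := by intro p _; simp
  add_mem' := by
    intro x y hx hy p hp
    simp [hx p hp, hy p hp]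
  smul_mem' := by
    intro c x hx p hp
    simp [← Complex.coe_smul, hx p hp]

theorem mem_realForm {P : Set E} {x : E} : x ∈ realForm P ↔ ∀ p ∈ P, (inner ℂ x p).im = 0 :=
  Iff.rfl

theorem isClosed_realForm (P : Set E) : IsClosed (realForm P : Set E) := by
  have : (realForm P : Set E) = ⋂ p ∈ P, {x | (inner ℂ x p).im = 0} := by
    ext x; simp [mem_realForm]
  rw [this]
  refine isClosed_biInter fun p _ => isClosed_eq ?_ continuous_const
  exact Complex.continuous_im.comp (continuous_id.inner continuous_const)

namespace IsSelfDualCone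

variable {P : Set E} (hP : IsSelfDualCone P)
include hP

theorem mem_iff {x : E} : x ∈ P ↔ ∀ ξ ∈ P, 0 ≤ inner ℂ x ξ := by
  conv_lhs => rw [hP.self_dual]
  rfl

theorem add_mem {x y : E} (hx : x ∈ P) (hy : y ∈ P) : x + y ∈ P := by
  rw [hP.mem_iff] at *
  intro ξ hξ
  rw [inner_add_left]
  exact add_nonneg (hx ξ hξ) (hy ξ hξ)

theorem zero_mem : (0 : E) ∈ P := by
  rw [hP.mem_iff]; intro ξ _; simp

theorem subset_realForm {x : E} (hx : x ∈ P) : x ∈ realForm P := fun p hp =>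
  (Complex.nonneg_iff.1 (hP.mem_iff.1 hx p hp)).2.symm

theorem eq_zero_of_inner {x : E} (hx : ∀ p ∈ P, inner ℂ x p = 0) : x = 0 :=
  inner_self_eq_zero.1 (hx x (hP.mem_iff.2 fun p hp => (hx p hp).ge))

/-- The real form meets its multiple by `I` only in zero. -/
theorem eq_zero_of_add_I_smul {u v : E} (hu : u ∈ realForm P) (hv : v ∈ realForm P)
    (h : u + Complex.I • v = 0) : u = 0 ∧ v = 0 := by
  have key : ∀ p ∈ P, inner ℂ u p = 0 ∧ inner ℂ v p = 0 := by
    intro p hp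
    have h1 : inner ℂ (u + Complex.I • v) p = 0 := by rw [h, inner_zero_left]
    rw [inner_add_left, inner_smul_left, Complex.ext_iff] at h1
    have hu' := hu p hp
    have hv' := hv p hp
    simp [hu', hv'] at h1
    exact ⟨Complex.ext h1.1 hu', Complex.ext h1.2 hv'⟩
  exact ⟨hP.eq_zero_of_inner fun p hp => (key p hp).1,
    hP.eq_zero_of_inner fun p hp => (key p hp).2⟩

variable [CompleteSpace E]

/-- Jordan decomposition with respect to a self-dual cone. -/
theorem exists_jordan {x : E} (hx : x ∈ realForm P) :
    ∃ p ∈ P, ∃ q ∈ P, x = p - q ∧ inner ℂ p q = 0 := by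
  obtain ⟨p, hp, hperp, hpol⟩ := exists_projection_cone hP.isClosed hP.convex hP.zero_mem
    (fun y hy => by rw [two_smul]; exact hP.add_mem hy hy) x
  have hreal : p - x ∈ realForm P := sub_mem (hP.subset_realForm hp) hx
  have hneg : ∀ q, inner ℂ (p - x) q = -inner ℂ (x - p) q := fun q => by
    rw [← inner_neg_left, neg_sub]
  refine ⟨p, hp, p - x, ?_, by abel, ?_⟩
  · rw [hP.mem_iff]
    intro ξ hξ
    refine Complex.nonneg_iff.2 ⟨?_, (hreal ξ hξ).symm⟩
    rw [hneg, Complex.neg_re]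
    linarith [hpol ξ hξ]
  · rw [inner_eq_zero_symm]
    refine Complex.ext ?_ (hreal p hp)
    rw [hneg, Complex.neg_re, hperp, neg_zero, Complex.zero_re]

/-- Project onto the real form: the remainder is real-orthogonal to the cone, so its inner products
with the cone are imaginary, and multiplying it by `-I` makes them real. -/
theorem exists_real_add_I_smul (x : E) :
    ∃ a ∈ realForm P, ∃ b ∈ realForm P, x = a + Complex.I • b := by
  obtain ⟨a, ha, -, hpol⟩ := exists_projection_cone (isClosed_realForm P) (realForm P).convex
    (realForm P).zero_mem (fun y hy => (realForm P).smul_mem 2 hy) x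
  refine ⟨a, ha, (-Complex.I) • (x - a), fun p hp => ?_, ?_⟩
  · have h1 := hpol p (hP.subset_realForm hp)
    have h2 := hpol (-p) (neg_mem (hP.subset_realForm hp))
    rw [inner_neg_right, Complex.neg_re] at h2
    rw [inner_smul_left]
    simp only [map_neg, Complex.conj_I, neg_neg, Complex.I_mul_im]
    linarith
  · rw [smul_smul]; simp

theorem map_realForm {R : E →L[ℂ] E} (hR : PositivityPreserving P R) {x : E}
    (hx : x ∈ realForm P) : R x ∈ realForm P := by
  obtain ⟨p, hp, q, hq, rfl, -⟩ := hP.exists_jordan hx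
  rw [map_sub]
  exact sub_mem (hP.subset_realForm (hR p hp)) (hP.subset_realForm (hR q hq))

end IsSelfDualCone

theorem StrictlyPositive.of_smul {P : Set E} (hP : IsSelfDualCone P) {r : ℝ} (hr : 0 < r) {x : E}
    (hx : StrictlyPositive P ((r : ℂ) • x)) : StrictlyPositive P x := by
  have hx' : ((r⁻¹ : ℝ) : ℂ) • ((r : ℂ) • x) = x := by
    rw [smul_smul, ← Complex.ofReal_mul, inv_mul_cancel₀ hr.ne', Complex.ofReal_one, one_smul]
  refine ⟨?_, fun ξ hξ h0 => ?_⟩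
  · rw [← hx']
    exact hP.smul_mem _ (inv_nonneg.2 hr.le) _ hx.1
  · rw [← hx', inner_smul_right]
    exact mul_pos (Complex.zero_lt_real.2 (inv_pos.2 hr)) (hx.2 ξ hξ h0)

theorem PositivityImproving.preserving {P : Set E} (hP : IsSelfDualCone P) {R : E →L[ℂ] E}
    (hR : PositivityImproving P R) : PositivityPreserving P R := fun ξ hξ => by
  by_cases h : ξ = 0
  · simpa [h] using hP.zero_mem
  · exact (hR ξ hξ h).1

/-- A real eigenvector of a positivity improving operator for the eigenvalue `‖R‖` has a strict
sign. -/
theorem PositivityImproving.strictlyPositive_or [CompleteSpace E] {P : Set E}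
    (hP : IsSelfDualCone P) {R : E →L[ℂ] E} (hR : PositivityImproving P R) {x : E}
    (hx : x ∈ realForm P) (h0 : x ≠ 0) (hRx : R x = ((‖R‖ : ℝ) : ℂ) • x) (hr : 0 < ‖R‖) :
    StrictlyPositive P x ∨ StrictlyPositive P (-x) := by
  obtain ⟨p, hp, q, hq, rfl, hpq⟩ := hP.exists_jordan hx
  have hqp : inner ℂ q p = 0 := inner_eq_zero_symm.1 hpq
  by_cases hq0 : q = 0
  · left
    subst hq0
    rw [sub_zero] at *
    exact StrictlyPositive.of_smul hP hr (hRx ▸ hR p hp h0)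
  by_cases hp0 : p = 0
  · right
    subst hp0
    rw [zero_sub, neg_neg] at *
    rw [map_neg, smul_neg, neg_inj] at hRx
    exact StrictlyPositive.of_smul hP hr (hRx ▸ hR q hq hq0)
  -- If both parts are nonzero, the cross terms are positive, so the quadratic form of `R` is
  -- strictly larger at `p + q` than at `p - q`. There it already equals `‖R‖` times the squared
  -- norm, which is the same for both vectors.
  exfalso
  have h1 := (Complex.pos_iff.1 ((hR q hq hq0).2 p hp hp0)).1
  have h2 := (Complex.pos_iff.1 ((hR p hp hp0).2 q hq hq0)).1
  have hup : (inner ℂ (p + q) (R (p + q))).re ≤ ‖R‖ * ‖p + q‖ ^ 2 := by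
    calc (inner ℂ (p + q) (R (p + q))).re ≤ ‖p + q‖ * ‖R (p + q)‖ :=
          re_inner_le_norm (𝕜 := ℂ) (p + q) (R (p + q))
      _ ≤ ‖p + q‖ * (‖R‖ * ‖p + q‖) := by gcongr; exact R.le_opNorm _
      _ = ‖R‖ * ‖p + q‖ ^ 2 := by ring
  have heq : (inner ℂ (p - q) (R (p - q))).re = ‖R‖ * ‖p - q‖ ^ 2 := by
    rw [hRx, inner_smul_right, Complex.re_ofReal_mul, inner_self_eq_norm_sq_to_K]
    norm_cast
  have hnorm : ‖p + q‖ ^ 2 = ‖p - q‖ ^ 2 := by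
    rw [norm_add_sq (𝕜 := ℂ), norm_sub_sq (𝕜 := ℂ), hpq]
    simp
  rw [hnorm, ← heq] at hup
  simp only [map_add, map_sub, inner_add_left, inner_add_right, inner_sub_left, inner_sub_right,
    Complex.add_re, Complex.sub_re] at hup
  linarith

/-- Perron-Frobenius: if `‖R‖` is an eigenvalue of the positivity improving operator `R`, its
eigenspace is spanned by one strictly positive vector. -/
theorem PositivityImproving.exists_groundState [CompleteSpace E] {P : Set E}
    (hP : IsSelfDualCone P) {R : E →L[ℂ] E} (hR : PositivityImproving P R) (hr : 0 < ‖R‖)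
    (hev : ∃ x, x ≠ 0 ∧ R x = ((‖R‖ : ℝ) : ℂ) • x) :
    ∃ ψ, ψ ≠ 0 ∧ StrictlyPositive P ψ ∧ R ψ = ((‖R‖ : ℝ) : ℂ) • ψ ∧
      ∀ x, R x = ((‖R‖ : ℝ) : ℂ) • x → x ∈ Submodule.span ℂ {ψ} := by
  have hsplit : ∀ x, R x = ((‖R‖ : ℝ) : ℂ) • x → ∃ a ∈ realForm P, ∃ b ∈ realForm P,
      x = a + Complex.I • b ∧ R a = ((‖R‖ : ℝ) : ℂ) • a ∧ R b = ((‖R‖ : ℝ) : ℂ) • b := by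
    intro x hx
    obtain ⟨a, ha, b, hb, rfl⟩ := hP.exists_real_add_I_smul x
    refine ⟨a, ha, b, hb, rfl, ?_⟩
    have hmem : ∀ y ∈ realForm P, R y - ((‖R‖ : ℝ) : ℂ) • y ∈ realForm P := fun y hy => by
      rw [Complex.coe_smul]
      exact sub_mem (hP.map_realForm (hR.preserving hP) hy) ((realForm P).smul_mem _ hy)
    have hz := hP.eq_zero_of_add_I_smul (hmem a ha) (hmem b hb) (by
      rw [map_add, map_smul] at hx
      linear_combination (norm := module) hx)
    exact ⟨sub_eq_zero.1 hz.1, sub_eq_zero.1 hz.2⟩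
  obtain ⟨ψ, hψ0, hψ, hRψ⟩ : ∃ ψ, ψ ≠ 0 ∧ StrictlyPositive P ψ ∧ R ψ = ((‖R‖ : ℝ) : ℂ) • ψ := by
    have hreal : ∃ y ∈ realForm P, y ≠ 0 ∧ R y = ((‖R‖ : ℝ) : ℂ) • y := by
      obtain ⟨x, hx0, hx⟩ := hev
      obtain ⟨a, ha, b, hb, rfl, hRa, hRb⟩ := hsplit x hx
      by_cases ha0 : a = 0
      · exact ⟨b, hb, fun hb0 => hx0 (by simp [ha0, hb0]), hRb⟩
      · exact ⟨a, ha, ha0, hRa⟩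
    obtain ⟨y, hy, hy0, hRy⟩ := hreal
    rcases hR.strictlyPositive_or hP hy hy0 hRy hr with h | h
    · exact ⟨y, hy0, h, hRy⟩
    · exact ⟨-y, neg_ne_zero.2 hy0, h, by rw [map_neg, hRy, smul_neg]⟩
  have hspan : ∀ y ∈ realForm P, R y = ((‖R‖ : ℝ) : ℂ) • y → y ∈ Submodule.span ℂ {ψ} := by
    intro y hy hRy
    rw [Submodule.mem_span_singleton]
    -- Subtracting the component along `ψ` leaves a real eigenvector orthogonal to `ψ`; were it
    -- nonzero, it would have a strict sign and could not be orthogonal to `ψ`.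
    set t : ℝ := (inner ℂ y ψ).re / ‖ψ‖ ^ 2 with ht
    refine ⟨(t : ℂ), ?_⟩
    by_contra hne
    have hzero : inner ℂ ψ (y - (t : ℂ) • ψ) = 0 := by
      have him := hy ψ hψ.1
      have hn : ‖ψ‖ ^ 2 ≠ 0 := by positivity
      have hreal : inner ℂ y ψ = ((inner ℂ y ψ).re : ℂ) := Complex.ext rfl him
      have hsq : inner ℂ ψ ψ = ((‖ψ‖ ^ 2 : ℝ) : ℂ) := by
        rw [inner_self_eq_norm_sq_to_K]; norm_cast
      rw [inner_eq_zero_symm, inner_sub_left, inner_smul_left, hsq, hreal, Complex.conj_ofReal,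
        ← Complex.ofReal_mul, ht, div_mul_cancel₀ _ hn, sub_self]
    have hne' : y - (t : ℂ) • ψ ≠ 0 := fun h => hne (sub_eq_zero.1 h).symm
    have hmem : y - (t : ℂ) • ψ ∈ realForm P := by
      rw [Complex.coe_smul]
      exact sub_mem hy ((realForm P).smul_mem _ (hP.subset_realForm hψ.1))
    have hRz : R (y - (t : ℂ) • ψ) = ((‖R‖ : ℝ) : ℂ) • (y - (t : ℂ) • ψ) := by
      rw [map_sub, map_smul, hRy, hRψ, smul_sub, smul_comm]
    rcases hR.strictlyPositive_or hP hmem hne' hRz hr with h | h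
    · exact (h.2 ψ hψ.1 hψ0).ne' hzero
    · refine (h.2 ψ hψ.1 hψ0).ne' ?_
      rw [inner_neg_right, hzero, neg_zero]
  refine ⟨ψ, hψ0, hψ, hRψ, fun x hx => ?_⟩
  obtain ⟨a, ha, b, hb, rfl, hRa, hRb⟩ := hsplit x hx
  exact add_mem (hspan a ha hRa) (Submodule.smul_mem _ _ (hspan b hb hRb))

end SelfDual

/-! ### Resolvents, the lowest energy, and strong commutation. -/

section Resolvent

variable {E : Type v} [NormedAddCommGroup E] [InnerProductSpace ℂ E]

theorem mem_opEigenspace {A : E →ₗ.[ℂ] E} {z : ℂ} {x : E} :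
    x ∈ opEigenspace A z ↔ ∃ h : x ∈ A.domain, A ⟨x, h⟩ = z • x := by
  change (x, z • x) ∈ A.graph ↔ _
  rw [LinearPMap.mem_graph_iff]
  constructor
  · rintro ⟨⟨y, hy⟩, rfl, h⟩
    exact ⟨hy, h⟩
  · rintro ⟨h, h'⟩
    exact ⟨⟨x, h⟩, rfl, h'⟩

namespace IsResolventAt

variable {A : E →ₗ.[ℂ] E} {z w : ℂ} {R T : E →L[ℂ] E}

theorem resolvent_identity (hR : IsResolventAt A z R) (hT : IsResolventAt A w T) :
    R - T = (z - w) • (R * T) := by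
  ext x
  obtain ⟨h, hx⟩ := hT.right_inv x
  have h1 := hR.left_inv ⟨T x, h⟩
  have h2 : A ⟨T x, h⟩ - z • T x = x - (z - w) • T x := by
    linear_combination (norm := module) hx
  simp only [h2, map_sub, map_smul] at h1
  change R x - T x = (z - w) • R (T x)
  linear_combination (norm := module) h1

theorem apply_eq_smul_iff (hR : IsResolventAt A z R) {l : ℂ} (hl : l ≠ 0) {x : E} :
    R x = l • x ↔ x ∈ opEigenspace A (z + l⁻¹) := by
  rw [mem_opEigenspace]
  constructor
  · intro h
    obtain ⟨hd, hx⟩ := hR.right_inv x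
    have hx' : x = l⁻¹ • R x := by rw [h, smul_smul, inv_mul_cancel₀ hl, one_smul]
    have hdx : x ∈ A.domain := by rw [hx']; exact A.domain.smul_mem _ hd
    refine ⟨hdx, ?_⟩
    have hs : (⟨x, hdx⟩ : A.domain) = l⁻¹ • ⟨R x, hd⟩ := Subtype.ext hx'
    have hA : A ⟨R x, hd⟩ = x + z • R x := eq_add_of_sub_eq hx
    rw [hs, A.map_smul, hA, smul_add, smul_comm, ← hx', add_smul, add_comm]
  · rintro ⟨h, hx⟩
    have h1 := hR.left_inv ⟨x, h⟩
    simp only [hx, add_smul, add_sub_cancel_left, map_smul] at h1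
    rw [← h1, smul_smul, h1, mul_inv_cancel₀ hl, one_smul]

theorem mem_opSpectrum (hR : IsResolventAt A z R) {l : ℂ} (hl : l ≠ 0)
    (h : l ∈ spectrum ℂ R) : z + l⁻¹ ∈ opSpectrum A := by
  rintro ⟨T, hT⟩
  refine h ?_
  have h1 := hR.resolvent_identity hT
  have h2 := hT.resolvent_identity hR
  rw [sub_add_cancel_left] at h1
  rw [add_sub_cancel_left] at h2
  rw [spectrum.mem_resolventSet_iff, Algebra.algebraMap_eq_smul_one]
  -- With `T` the resolvent at `z + l⁻¹`, the resolvent identity in both orders shows that this is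
  -- the inverse of `l - R`.
  refine ⟨⟨l • 1 - R, l⁻¹ • 1 + l⁻¹ • l⁻¹ • T, ?_, ?_⟩, rfl⟩
  · simp only [sub_mul, mul_add, smul_mul_assoc, mul_smul_comm, one_mul, mul_one, smul_sub,
      inv_smul_smul₀ hl]
    linear_combination (norm := module) -(l⁻¹ • h1)
  · simp only [mul_sub, add_mul, smul_mul_assoc, mul_smul_comm, one_mul, mul_one, smul_add,
      smul_inv_smul₀ hl]
    linear_combination (norm := module) l⁻¹ • h2

theorem injective (hR : IsResolventAt A z R) {x : E} (hx : R x = 0) : x = 0 := by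
  obtain ⟨h, h'⟩ := hR.right_inv x
  have h0 : (⟨R x, h⟩ : A.domain) = 0 := Subtype.ext hx
  rw [h0, hx, A.map_zero, smul_zero, sub_zero] at h'
  exact h'.symm

variable [CompleteSpace E]

theorem isSelfAdjoint {s : ℝ} (hA : IsSelfAdjoint A) (hR : IsResolventAt A (s : ℂ) R) :
    IsSelfAdjoint R := by
  rw [ContinuousLinearMap.isSelfAdjoint_iff_isSymmetric]
  intro x y
  have hsymm : ∀ u v : A.domain, inner ℂ (A u) (v : E) = inner ℂ (u : E) (A v) := by
    have h := LinearPMap.adjoint_isFormalAdjoint hA.dense_domain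
    rw [LinearPMap.isSelfAdjoint_def.1 hA] at h
    exact fun u v => h u v
  obtain ⟨hx, hx'⟩ := hR.right_inv x
  obtain ⟨hy, hy'⟩ := hR.right_inv y
  change inner ℂ (R x) y = inner ℂ x (R y)
  have := hsymm ⟨R x, hx⟩ ⟨R y, hy⟩
  rw [eq_add_of_sub_eq hx', eq_add_of_sub_eq hy'] at this
  simpa [inner_add_left, inner_add_right, inner_smul_left, inner_smul_right] using this.symm

end IsResolventAt

theorem exists_mem_spectrum_abs_eq_norm [CompleteSpace E] [Nontrivial E] {R : E →L[ℂ] E}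
    (hR : IsSelfAdjoint R) : ∃ l : ℝ, (l : ℂ) ∈ spectrum ℂ R ∧ |l| = ‖R‖ := by
  obtain ⟨z, hz, hn⟩ := spectrum.exists_nnnorm_eq_spectralRadius R
  rw [hR.spectralRadius_eq_nnnorm] at hn
  have hre := hR.mem_spectrum_eq_re hz
  refine ⟨z.re, hre ▸ hz, ?_⟩
  have hn' : ‖z‖ = ‖R‖ := congrArg NNReal.toReal (ENNReal.coe_injective hn)
  rw [← hn', hre, Complex.norm_real, Complex.ofReal_re, Real.norm_eq_abs]

/-- The lowest energy is a simple eigenvalue, with a strictly positive eigenvector. -/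
theorem PositiveClass.exists_groundState [CompleteSpace E] [Nontrivial E] {P : Set E}
    {A : E →ₗ.[ℂ] E} (hP : IsSelfDualCone P) (hA : PositiveClass P A) :
    ∃ ψ, ψ ≠ 0 ∧ StrictlyPositive P ψ ∧
      opEigenspace A (lowestEnergy A : ℂ) = Submodule.span ℂ {ψ} := by
  set e := lowestEnergy A with he
  obtain ⟨R, hR, himp⟩ := hA.improving (1 - e) (by linarith)
  have hz : -((1 - e : ℝ) : ℂ) = ((e - 1 : ℝ) : ℂ) := by push_cast; ring
  rw [hz] at hR
  have hsa := hR.isSelfAdjoint hA.isSelfAdjoint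
  -- The lower bound comes from the resolvents assumed to exist below `e`, since the spectrum is not
  -- yet known to be nonempty.
  have hlow : ∀ t : ℝ, (t : ℂ) ∈ opSpectrum A → e ≤ t := by
    intro t ht
    by_contra hlt
    obtain ⟨T, hT, -⟩ := hA.improving (-t) (by linarith)
    exact ht ⟨T, by simpa using hT⟩
  have hr : 0 < ‖R‖ := by
    rw [norm_pos_iff]
    rintro rfl
    obtain ⟨y, hy⟩ := exists_ne (0 : E)
    exact hy (hR.injective (x := y) rfl)
  obtain ⟨l, hl, hlR⟩ := exists_mem_spectrum_abs_eq_norm hsa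
  have hl0 : l ≠ 0 := by rintro rfl; simp at hlR; linarith
  have hmem : ((e - 1 + l⁻¹ : ℝ) : ℂ) ∈ opSpectrum A := by
    have := hR.mem_opSpectrum (Complex.ofReal_ne_zero.2 hl0) hl
    push_cast at this ⊢
    exact this
  have hlpos : 0 < l := by
    have := hlow _ hmem
    exact inv_pos.1 (by linarith)
  rw [abs_of_pos hlpos] at hlR
  -- By discreteness `t` is an eigenvalue of `A`, hence `(t - (e - 1))⁻¹` is one of `R` and is at
  -- most `‖R‖ = l`. So the infimum is attained and corresponds to the top eigenvalue of `R`.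
  have hle : ∀ t : ℝ, (t : ℂ) ∈ opSpectrum A → e - 1 + l⁻¹ ≤ t := by
    intro t ht
    have ht1 : 0 < t - (e - 1) := by linarith [hlow t ht]
    obtain ⟨x, hx, hx0⟩ := (Submodule.ne_bot_iff _).1 (hA.discrete _ ht).2.1
    have hev : R x = (((t - (e - 1))⁻¹ : ℝ) : ℂ) • x := by
      rw [hR.apply_eq_smul_iff (by exact_mod_cast (inv_pos.2 ht1).ne')]
      convert hx using 2
      push_cast
      rw [inv_inv]; ring
    have hb := R.le_opNorm x
    rw [hev, norm_smul, Complex.norm_real, Real.norm_of_nonneg (inv_pos.2 ht1).le, ← hlR] at hb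
    have := le_of_mul_le_mul_right hb (norm_pos_iff.2 hx0)
    have := inv_anti₀ (inv_pos.2 ht1) this
    rw [inv_inv] at this
    linarith
  have hE : e = e - 1 + l⁻¹ :=
    (IsLeast.csInf_eq ⟨hmem, hle⟩ : lowestEnergy A = e - 1 + l⁻¹)
  have hiff : ∀ x, R x = ((‖R‖ : ℝ) : ℂ) • x ↔ x ∈ opEigenspace A (e : ℂ) := by
    intro x
    rw [hR.apply_eq_smul_iff (Complex.ofReal_ne_zero.2 hr.ne'), ← hlR]
    conv_rhs => rw [hE]
    push_cast
    rfl
  obtain ⟨ψ, h0, hψ, hRψ, hspan⟩ := himp.exists_groundState hP hr (by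
    rw [← hE] at hmem
    obtain ⟨x, hx, hx0⟩ := (Submodule.ne_bot_iff _).1 (hA.discrete _ hmem).2.1
    exact ⟨x, hx0, (hiff x).2 hx⟩)
  refine ⟨ψ, h0, hψ, le_antisymm (fun x hx => hspan x ((hiff x).2 hx)) ?_⟩
  rw [Submodule.span_singleton_le_iff_mem]
  exact (hiff ψ).1 hRψ

/-- A bounded operator that commutes strongly with `A` preserves the eigenspaces of `A`. -/
theorem StronglyCommutes.map_opEigenspace [CompleteSpace E] {A : E →ₗ.[ℂ] E} {B : E →L[ℂ] E}
    (h : StronglyCommutes A B) {z : ℂ} (hfin : FiniteDimensional ℂ (opEigenspace A z)) {x : E}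
    (hx : x ∈ opEigenspace A z) : B x ∈ opEigenspace A z := by
  obtain ⟨U, hU, hcomm⟩ := h
  have hexp : ∀ s : ℝ, NormedSpace.exp (s • (Complex.I • B)) x ∈ opEigenspace A z := by
    intro s
    have hs : s • (Complex.I • B) = (Complex.I * (s : ℂ)) • B := by
      rw [← Complex.coe_smul, smul_smul, mul_comm]
    rw [hs]
    set V := NormedSpace.exp ((Complex.I * (s : ℂ)) • B) with hV
    have hd : HasDerivAt (fun t : ℝ => U t x) (Complex.I • z • x) 0 := (hU.generator _ _).1 hx
    have hd' := (V.restrictScalars ℝ).hasFDerivAt.comp_hasDerivAt (0 : ℝ) hd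
    refine (hU.generator _ _).2 ?_
    convert hd' using 1
    · funext t
      exact (congrArg (fun W : E →L[ℂ] E => W x) (hcomm s t)).symm
    · simp
  have hder : HasDerivAt (fun s : ℝ => NormedSpace.exp (s • (Complex.I • B)) x)
      (Complex.I • B x) 0 := by
    have h1 := hasDerivAt_exp_smul_const (𝕂 := ℝ) (Complex.I • B) (0 : ℝ)
    have h2 := (((ContinuousLinearMap.apply ℂ E x).restrictScalars ℝ).hasFDerivAt).comp_hasDerivAt
      (0 : ℝ) h1
    simpa [Function.comp_def] using h2
  -- The curve `exp(isB) x` stays in the eigenspace; closedness puts its derivative `iBx` at `s = 0`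
  -- there too.
  have hcl : IsClosed (opEigenspace A z : Set E) := Submodule.closed_of_finiteDimensional _
  have hmem : Complex.I • B x ∈ opEigenspace A z := by
    refine hcl.mem_of_tendsto (hasDerivAt_iff_tendsto_slope_zero.1 hder)
      (Filter.Eventually.of_forall fun t => ?_)
    rw [← Complex.coe_smul]
    exact Submodule.smul_mem _ _ (sub_mem (hexp _) (hexp _))
  have := (opEigenspace A z).smul_mem (-Complex.I) hmem
  rwa [smul_smul, neg_mul, Complex.I_mul_I, neg_neg, one_smul] at this

end Resolvent

/-! ### Transport of the quantum number along links and chains. -/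

section Main

variable {𝔥 : Type u} [NormedAddCommGroup 𝔥] [InnerProductSpace ℂ 𝔥] [CompleteSpace 𝔥]

theorem isSelfAdjoint_extend {O : 𝔥 →L[ℂ] 𝔥} (hO : IsSelfAdjoint O) (H : OperatorOver.{u, v} 𝔥) :
    IsSelfAdjoint (extend O H) :=
  hO.conj_adjoint H.embed.toContinuousLinearMap

/-- A ground state is an eigenvector of `O`. -/
theorem exists_extend_eigenvalue {O : 𝔥 →L[ℂ] 𝔥} (hO : IsSelfAdjoint O)
    {H : OperatorOver.{u, v} 𝔥} (hH : StronglyCommutes H.op (extend O H)) {z : ℂ} {ψ : H.Space}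
    (h0 : ψ ≠ 0) (hψ : opEigenspace H.op z = Submodule.span ℂ {ψ}) :
    ∃ m : ℝ, extend O H ψ = (m : ℂ) • ψ := by
  have hfin : FiniteDimensional ℂ (opEigenspace H.op z) := by rw [hψ]; infer_instance
  have hmem := hH.map_opEigenspace hfin (x := ψ) (hψ ▸ Submodule.mem_span_singleton_self ψ)
  rw [hψ, Submodule.mem_span_singleton] at hmem
  obtain ⟨c, hc⟩ := hmem
  have hsymm := (isSelfAdjoint_extend hO H).isSymmetric ψ ψ
  change inner ℂ (extend O H ψ) ψ = inner ℂ ψ (extend O H ψ) at hsymm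
  rw [← hc, inner_smul_left, inner_smul_right] at hsymm
  have hc' := mul_right_cancel₀ (inner_self_ne_zero.2 h0) hsymm
  exact ⟨c.re, by rw [Complex.conj_eq_iff_re.1 hc', hc]⟩

/-- Lets the number picked by `Classical.epsilon` be read off from any ground state, in particular
from a strictly positive one. -/
theorem IsGoodQuantumNumber.unique {O : 𝔥 →L[ℂ] 𝔥} {H : OperatorOver.{u, v} 𝔥} {m : ℝ} {ψ : H.Space}
    (hm : IsGoodQuantumNumber O H m) (hψ : ψ ∈ opEigenspace H.op (lowestEnergy H.op : ℂ))
    (h0 : ψ ≠ 0) : extend O H ψ = (m : ℂ) • ψ := by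
  obtain ⟨φ, -, hspan, hφ⟩ := hm
  rw [hspan, Submodule.mem_span_singleton] at hψ
  obtain ⟨c, rfl⟩ := hψ
  rw [map_smul, hφ, smul_comm]

theorem isGoodQuantumNumber_goodQuantumNumber {O : 𝔥 →L[ℂ] 𝔥} (hO : IsSelfAdjoint O)
    {H : OperatorOver.{u, v} 𝔥} [Nontrivial H.Space] (hH : MemClass O H) :
    IsGoodQuantumNumber O H (goodQuantumNumber O H) := by
  obtain ⟨P, hP, hA⟩ := hH.positive
  obtain ⟨ψ, h0, -, hspan⟩ := hA.exists_groundState hP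
  obtain ⟨m, hm⟩ := exists_extend_eigenvalue hO hH.commutes h0 hspan
  exact Classical.epsilon_spec (p := fun m : ℝ => IsGoodQuantumNumber O H m) ⟨m, ψ, h0, hspan, hm⟩

/-- The good quantum number is constant along a link. -/
theorem Link.goodQuantumNumber_eq {O : 𝔥 →L[ℂ] 𝔥} (hO : IsSelfAdjoint O)
    {H₁ H₂ : OperatorOver.{u, v} 𝔥} [Nontrivial H₁.Space] (h₁ : MemClass O H₁) (h₂ : MemClass O H₂)
    (h : Link H₁ H₂) :
    Nontrivial H₂.Space ∧ goodQuantumNumber O H₂ = goodQuantumNumber O H₁ := by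
  obtain ⟨j, P₁, P₂, hj, hP₁, hP₂, hA₁, hA₂, hproj, hpos⟩ := h
  have hnt : Nontrivial H₂.Space := j.injective.nontrivial
  refine ⟨hnt, ?_⟩
  obtain ⟨ψ₁, h01, hψ₁, hspan₁⟩ := hA₁.exists_groundState hP₁
  obtain ⟨ψ₂, h02, hψ₂, hspan₂⟩ := hA₂.exists_groundState hP₂
  have hm₁ := (isGoodQuantumNumber_goodQuantumNumber hO h₁).unique
    (hspan₁ ▸ Submodule.mem_span_singleton_self ψ₁) h01
  have hm₂ := (isGoodQuantumNumber_goodQuantumNumber hO h₂).unique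
    (hspan₂ ▸ Submodule.mem_span_singleton_self ψ₂) h02
  have hext : extend O H₂ (j ψ₁) = j (extend O H₁ ψ₁) := by
    have hadj : ContinuousLinearMap.adjoint H₂.embed.toContinuousLinearMap (j ψ₁) =
        ContinuousLinearMap.adjoint H₁.embed.toContinuousLinearMap ψ₁ := by
      refine ext_inner_right ℂ fun x => ?_
      rw [ContinuousLinearMap.adjoint_inner_left, ContinuousLinearMap.adjoint_inner_left]
      change inner ℂ (j ψ₁) (H₂.embed x) = inner ℂ ψ₁ (H₁.embed x)
      rw [← hj, j.inner_map_map]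
    simp only [extend, ContinuousLinearMap.comp_apply, hadj]
    exact (hj _).symm
  -- Since `P₁ = πP₂`, the vector is `πy` for some `y ∈ P₂`, and `π` preserves `P₂`.
  have hjP : j ψ₁ ∈ P₂ := by
    have hmem := hψ₁.1
    rw [hproj] at hmem
    obtain ⟨y, hy, hyψ⟩ := hmem
    rw [← hyψ]
    exact hpos y hy
  have hne : inner ℂ (j ψ₁) ψ₂ ≠ 0 :=
    (hψ₂.2 _ hjP ((map_ne_zero_iff j j.injective).2 h01)).ne'
  have hsymm := (isSelfAdjoint_extend hO H₂).isSymmetric (j ψ₁) ψ₂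
  change inner ℂ (extend O H₂ (j ψ₁)) ψ₂ = inner ℂ (j ψ₁) (extend O H₂ ψ₂) at hsymm
  rw [hext, hm₁, hm₂, map_smul, inner_smul_left, inner_smul_right, Complex.conj_ofReal] at hsymm
  exact (Complex.ofReal_injective (mul_right_cancel₀ hne hsymm)).symm

theorem Arrow.goodQuantumNumber_eq {O : 𝔥 →L[ℂ] 𝔥} (hO : IsSelfAdjoint O)
    {H₁ H₂ : OperatorOver.{u, v} 𝔥} [Nontrivial H₁.Space] (h : Arrow O H₁ H₂) :
    Nontrivial H₂.Space ∧ goodQuantumNumber O H₂ = goodQuantumNumber O H₁ := by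
  induction h with
  | single h => exact h.2.2.goodQuantumNumber_eq hO h.1 h.2.1
  | tail _ h ih =>
    obtain ⟨hnt, heq⟩ := ih
    have := h.2.2.goodQuantumNumber_eq hO h.1 h.2.1
    exact ⟨this.1, this.2.trans heq⟩

end Main

end GoodQN

theorem theorem3p3 {𝔥 : Type u} [NormedAddCommGroup 𝔥] [InnerProductSpace ℂ 𝔥] [CompleteSpace 𝔥]
    (O : 𝔥 →L[ℂ] 𝔥) (hO : IsSelfAdjoint O) (hOd : GoodQN.HasTotalEigenvectors O)
    (Hs : GoodQN.OperatorOver.{u, v} 𝔥) [Nontrivial Hs.Space] (hHs : GoodQN.MemClass O Hs)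
    (H : GoodQN.OperatorOver.{u, v} 𝔥) (hH : H ∈ GoodQN.stabilityClass O Hs) :
    GoodQN.IsGoodQuantumNumber O Hs (GoodQN.goodQuantumNumber O Hs) ∧
    GoodQN.IsGoodQuantumNumber O H (GoodQN.goodQuantumNumber O H) ∧
    GoodQN.goodQuantumNumber O H = GoodQN.goodQuantumNumber O Hs := by
  obtain ⟨hnt, heq⟩ := hH.2.goodQuantumNumber_eq hO
  exact ⟨GoodQN.isGoodQuantumNumber_goodQuantumNumber hO hHs,
    GoodQN.isGoodQuantumNumber_goodQuantumNumber hO hH.1, heq⟩
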